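/- Definitions. Let $\mathbf C$ be a symmetric monoidal category with unit $I$. For morphisms $f,g$ write $f\pitchfork g$ if every commuting square $g\circ a=b\circ f$ has a diagonal $h$ with $h\circ f=a$ and $g\circ h=b$, and write $f\oslash g$ if $(f\otimes \mathrm{id}_A)\pitchfork(g\otimes\mathrm{id}_B)$ for all objects $A,B$. For a class $\mathcal A$ of morphisms let $\mathcal A^{\oslash}=\{g\mid f\oslash g \text{ for all } f\in\mathcal A\}$ and ${}^{\oslash}\mathcal A=\{f\mid f\oslash g\text{ for all }g\in\mathcal A\}$. A pair $(\mathcal L,\mathcal R)$ of classes of morphisms is a *symmetric monoidal weak factorisation system* if every morphism equals $r\circ l$ for some $l\in\mathcal L$, $r\in\mathcal R$, and $\mathcal L={}^{\oslash}\mathcal R$, $\mathcal R=\mathcal L^{\oslash}$. Given a family $\mathcal M'$ of completely mixed states $m_C\colon I\to C$, for $C$ in a collection of objects, let $\mathcal P=\mathcal M'^{\oslash}$ (pure morphisms) and $\mathcal M={}^{\oslash}\mathcal P$ (mixing morphisms); $\mathbf C$ *has purification* if every morphism $f\colon A\to B$ equals $A\cong A\otimes I\xrightarrow{\mathrm{id}_A\otimes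 m_C}A\otimes C\xrightarrow{\,p\,}B$ for some $m_C$ in $\mathcal M'$ and some $p\in\mathcal P$. Given a family $\mathcal D'$ of discarding effects $d_C\colon C\to I$, let $\mathcal C={}^{\oslash}\mathcal D'$ (copure morphisms) and $\mathcal D=\mathcal C^{\oslash}$ (discarding morphisms); $\mathbf C$ *has copurification* if every $f\colon A\to B$ equals $A\xrightarrow{\,c\,}C\otimes B\xrightarrow{d_C\otimes\mathrm{id}_B}I\otimes B\cong B$ for some $d_C$ in $\mathcal D'$ and some $c\in\mathcal C$. Let $\mathbf{Quant}$ be the symmetric monoidal category of finite-dimensional complex Hilbert spaces in which a morphism $H\to K$ is a (not necessarily trace-preserving) completely positive linear map $\mathrm{End}(H)\to\mathrm{End}(K)$, with the usual tensor product. For each nonzero $H$ let $m_H\colon\mathbb C\to H$ be the state whose density operator is $\mathrm{id}_H$, and let $d_H\colon H\to\mathbb C$ be the trace. Theorem. With the completely mixed states $m_H$ and the discarding effects $d_H$, for $H\neq 0$, the category $\mathbf{Quant}$ has purification and copurification, and the pairs $(\mathcal M,\mathcal P)$ and $(\mathcal C,\mathcal D)$ are symmetric monoidal weak factorisation systems.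 The same holds for the full symmetric monoidal subcategory of $\mathbf{Quant}$ on the nonzero Hilbert spaces (in which every object $H$ is equipped with $m_H$ and $d_H$, and all of the notions above are formed within the subcategory). -/

import Mathlib

open CategoryTheory MonoidalCategory TensorProduct

noncomputable section

/-! ## Tensor lifting, purity and purification in a symmetric monoidal category -/

namespace MonoidalLifting

universe v u w

variable {V : Type u} [Category.{v} V] [MonoidalCategory V] [SymmetricCategory V]

/-- `f ⊘ g`: for all objects `A`, `B`, the morphism `f ⊗ id_A` has the left lifting property
against `g ⊗ id_B`. -/
def TensorLifts {X Y Z W : V} (f : X ⟶ Y) (g : Z ⟶ W) : Prop :=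
  ∀ A B : V, HasLiftingProperty (f ▷ A) (g ▷ B)

/-- The class of all `g` with `f ⊘ g` for every `f` in `𝒜`. -/
def rightTensorLift (𝒜 : MorphismProperty V) : MorphismProperty V :=
  fun _ _ g => ∀ ⦃X Y : V⦄ (f : X ⟶ Y), 𝒜 f → TensorLifts f g

/-- The class of all `f` with `f ⊘ g` for every `g` in `𝒜`. -/
def leftTensorLift (𝒜 : MorphismProperty V) : MorphismProperty V :=
  fun _ _ f => ∀ ⦃Z W : V⦄ (g : Z ⟶ W), 𝒜 g → TensorLifts f g

/-- A symmetric monoidal weak factorisation system: every morphism is `r ∘ l` with `l` in `L` and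
`r` in `R`, and each of the two classes is determined by the other through `⊘`. -/
structure IsSymmetricMonoidalWFS (L R : MorphismProperty V) : Prop where
  factorisation : ∀ ⦃X Y : V⦄ (f : X ⟶ Y), ∃ (Z : V) (l : X ⟶ Z) (r : Z ⟶ Y),
    L l ∧ R r ∧ l ≫ r = f
  left_eq : L = leftTensorLift R
  right_eq : R = rightTensorLift L

section States

/-! A family of completely mixed states `mix i : I ⟶ C i`. -/

variable {ι : Type w} {C : ι → V} (mix : ∀ i, 𝟙_ V ⟶ C i)

/-- The pure morphisms determined by a family of completely mixed states. -/
def pureMorphisms : MorphismProperty V :=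
  rightTensorLift (MorphismProperty.ofHoms mix)

/-- The mixing morphisms determined by a family of completely mixed states. -/
def mixingMorphisms : MorphismProperty V :=
  leftTensorLift (pureMorphisms mix)

/-- Every morphism `A ⟶ B` arises by adjoining a completely mixed state of some ancilla `C` to the
right of `A` and then applying a pure morphism `p : A ⊗ C ⟶ B`. -/
def HasPurification : Prop :=
  ∀ ⦃A B : V⦄ (f : A ⟶ B), ∃ (i : ι) (p : A ⊗ C i ⟶ B),
    pureMorphisms mix p ∧ f = (ρ_ A).inv ≫ (A ◁ mix i) ≫ p

end States

section Effects

/-! A family of discarding effects `disc i : C i ⟶ I`. -/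

variable {ι : Type w} {C : ι → V} (disc : ∀ i, C i ⟶ 𝟙_ V)

/-- The copure morphisms determined by a family of discarding effects. -/
def copureMorphisms : MorphismProperty V :=
  leftTensorLift (MorphismProperty.ofHoms disc)

/-- The discarding morphisms determined by a family of discarding effects. -/
def discardingMorphisms : MorphismProperty V :=
  rightTensorLift (copureMorphisms disc)

/-- Every morphism `A ⟶ B` arises by applying a copure morphism `c : A ⟶ C ⊗ B` and then
discarding the left factor `C`. -/
def HasCopurification : Prop :=
  ∀ ⦃A B : V⦄ (f : A ⟶ B), ∃ (i : ι) (c : A ⟶ C i ⊗ B),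
    copureMorphisms disc c ∧ f = c ≫ (disc i ▷ B) ≫ (λ_ B).hom

end Effects

end MonoidalLifting

/-! ## Linear maps between operator spaces -/

namespace SuperOp

set_option linter.unusedSectionVars false

section

variable {H K L M N H' K' L' : Type*}
  [NormedAddCommGroup H] [InnerProductSpace ℂ H] [FiniteDimensional ℂ H]
  [NormedAddCommGroup K] [InnerProductSpace ℂ K] [FiniteDimensional ℂ K]
  [NormedAddCommGroup L] [InnerProductSpace ℂ L] [FiniteDimensional ℂ L]
  [NormedAddCommGroup M] [InnerProductSpace ℂ M] [FiniteDimensional ℂ M]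
  [NormedAddCommGroup H'] [InnerProductSpace ℂ H'] [FiniteDimensional ℂ H']
  [NormedAddCommGroup K'] [InnerProductSpace ℂ K'] [FiniteDimensional ℂ K']
  [NormedAddCommGroup L'] [InnerProductSpace ℂ L'] [FiniteDimensional ℂ L']
  [AddCommGroup N] [Module ℂ N]

/-- The tensor product of two linear maps between operator spaces, under the identification
`End (H ⊗ L) = End H ⊗ End L`. It is determined by `S ⊗ T ↦ Φ S ⊗ Ψ T`, see `superTensor_map`. -/
def superTensor (Φ : Module.End ℂ H →ₗ[ℂ] Module.End ℂ K) (Ψ : Module.End ℂ L →ₗ[ℂ] Module.End ℂ M) :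
    Module.End ℂ (H ⊗[ℂ] L) →ₗ[ℂ] Module.End ℂ (K ⊗[ℂ] M) :=
  (homTensorHomEquiv ℂ K M K M).toLinearMap ∘ₗ TensorProduct.map Φ Ψ ∘ₗ
    (homTensorHomEquiv ℂ H L H L).symm.toLinearMap

@[simp] theorem superTensor_map (Φ : Module.End ℂ H →ₗ[ℂ] Module.End ℂ K)
    (Ψ : Module.End ℂ L →ₗ[ℂ] Module.End ℂ M) (S : Module.End ℂ H) (T : Module.End ℂ L) :
    superTensor Φ Ψ (TensorProduct.map S T) = TensorProduct.map (Φ S) (Ψ T) := by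
  have h : (homTensorHomEquiv ℂ H L H L).symm (TensorProduct.map S T) = S ⊗ₜ[ℂ] T := by
    rw [LinearEquiv.symm_apply_eq, homTensorHomEquiv_apply]
    rfl
  simp only [superTensor, LinearMap.comp_apply, LinearEquiv.coe_coe, h, TensorProduct.map_tmul,
    homTensorHomEquiv_apply]
  rfl

theorem ext₂ {f g : Module.End ℂ (H ⊗[ℂ] K) →ₗ[ℂ] N}
    (h : ∀ (S : Module.End ℂ H) (T : Module.End ℂ K),
      f (TensorProduct.map S T) = g (TensorProduct.map S T)) : f = g := by
  have key : f ∘ₗ (homTensorHomEquiv ℂ H K H K).toLinearMap =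
      g ∘ₗ (homTensorHomEquiv ℂ H K H K).toLinearMap := by
    apply TensorProduct.ext'
    intro S T
    simp only [LinearMap.comp_apply, LinearEquiv.coe_coe, homTensorHomEquiv_apply]
    exact h S T
  apply LinearMap.ext
  intro X
  obtain ⟨Y, rfl⟩ := (homTensorHomEquiv ℂ H K H K).surjective X
  exact LinearMap.congr_fun key Y

theorem ext₃ {f g : Module.End ℂ ((H ⊗[ℂ] K) ⊗[ℂ] L) →ₗ[ℂ] N}
    (h : ∀ (S : Module.End ℂ H) (T : Module.End ℂ K) (U : Module.End ℂ L),
      f (TensorProduct.map (TensorProduct.map S T) U) =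
        g (TensorProduct.map (TensorProduct.map S T) U)) : f = g := by
  apply ext₂
  intro X U
  have : f ∘ₗ (TensorProduct.mapBilinear (.id ℂ) (H ⊗[ℂ] K) L (H ⊗[ℂ] K) L).flip U =
      g ∘ₗ (TensorProduct.mapBilinear (.id ℂ) (H ⊗[ℂ] K) L (H ⊗[ℂ] K) L).flip U :=
    ext₂ fun S T => h S T U
  exact LinearMap.congr_fun this X

theorem ext₄ {f g : Module.End ℂ (((H ⊗[ℂ] K) ⊗[ℂ] L) ⊗[ℂ] M) →ₗ[ℂ] N}
    (h : ∀ (S : Module.End ℂ H) (T : Module.End ℂ K) (U : Module.End ℂ L) (W : Module.End ℂ M),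
      f (TensorProduct.map (TensorProduct.map (TensorProduct.map S T) U) W) =
        g (TensorProduct.map (TensorProduct.map (TensorProduct.map S T) U) W)) : f = g := by
  refine ext₂ (H := (H ⊗[ℂ] K) ⊗[ℂ] L) (K := M) fun X W => ?_
  have : f ∘ₗ (TensorProduct.mapBilinear (.id ℂ) ((H ⊗[ℂ] K) ⊗[ℂ] L) M
        ((H ⊗[ℂ] K) ⊗[ℂ] L) M).flip W =
      g ∘ₗ (TensorProduct.mapBilinear (.id ℂ) ((H ⊗[ℂ] K) ⊗[ℂ] L) M
        ((H ⊗[ℂ] K) ⊗[ℂ] L) M).flip W :=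
    ext₃ fun S T U => h S T U W
  exact LinearMap.congr_fun this X

theorem ext₃' {f g : Module.End ℂ (H ⊗[ℂ] (K ⊗[ℂ] L)) →ₗ[ℂ] N}
    (h : ∀ (S : Module.End ℂ H) (T : Module.End ℂ K) (U : Module.End ℂ L),
      f (TensorProduct.map S (TensorProduct.map T U)) =
        g (TensorProduct.map S (TensorProduct.map T U))) : f = g := by
  apply ext₂
  intro S X
  have : f ∘ₗ (TensorProduct.mapBilinear (.id ℂ) H (K ⊗[ℂ] L) H (K ⊗[ℂ] L)) S =
      g ∘ₗ (TensorProduct.mapBilinear (.id ℂ) H (K ⊗[ℂ] L) H (K ⊗[ℂ] L)) S :=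
    ext₂ fun T U => h S T U
  exact LinearMap.congr_fun this X

/-- The linear map `S ↦ A S A†`. -/
def sandwich (A : H →ₗ[ℂ] K) : Module.End ℂ H →ₗ[ℂ] Module.End ℂ K where
  toFun S := A ∘ₗ S ∘ₗ LinearMap.adjoint A
  map_add' S T := by ext; simp
  map_smul' c S := by ext; simp

theorem sandwich_apply (A : H →ₗ[ℂ] K) (S : Module.End ℂ H) :
    sandwich A S = A ∘ₗ S ∘ₗ LinearMap.adjoint A := rfl

theorem sandwich_superTensor_id (A : H →ₗ[ℂ] K) :
    superTensor (sandwich A) (LinearMap.id : Module.End ℂ L →ₗ[ℂ] Module.End ℂ L) =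
      sandwich (TensorProduct.map A LinearMap.id) := by
  apply ext₂
  intro S T
  simp only [superTensor_map, sandwich_apply, TensorProduct.adjoint_map, LinearMap.adjoint_id,
    LinearMap.id_apply, ← TensorProduct.map_comp, LinearMap.id_comp, LinearMap.comp_id]

/-- Conjugation `S ↦ e S e⁻¹` by a unitary. -/
def conj (e : H ≃ₗᵢ[ℂ] K) : Module.End ℂ H →ₗ[ℂ] Module.End ℂ K :=
  e.toLinearEquiv.conj.toLinearMap

theorem conj_eq_sandwich (e : H ≃ₗᵢ[ℂ] K) : conj e = sandwich e.toLinearEquiv.toLinearMap := by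
  apply LinearMap.ext
  intro S
  have : LinearMap.adjoint e.toLinearEquiv.toLinearMap = e.symm.toLinearEquiv.toLinearMap := by
    symm
    rw [LinearMap.eq_adjoint_iff]
    intro x y
    exact e.symm.inner_map_eq_flip x y
  rw [sandwich_apply, this]
  rfl

theorem conj_apply_apply (e : H ≃ₗᵢ[ℂ] K) (S : Module.End ℂ H) (x : K) :
    conj e S x = e (S (e.symm x)) := rfl

@[simp] theorem conj_assoc (S : Module.End ℂ H) (T : Module.End ℂ K) (U : Module.End ℂ L) :
    conj (assocIsometry ℂ H K L) (TensorProduct.map (TensorProduct.map S T) U) =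
      TensorProduct.map S (TensorProduct.map T U) := by
  apply TensorProduct.ext_threefold'
  intro x y z
  rfl

@[simp] theorem conj_assoc_symm (S : Module.End ℂ H) (T : Module.End ℂ K) (U : Module.End ℂ L) :
    conj (assocIsometry ℂ H K L).symm (TensorProduct.map S (TensorProduct.map T U)) =
      TensorProduct.map (TensorProduct.map S T) U := by
  apply TensorProduct.ext_threefold
  intro x y z
  rfl

@[simp] theorem conj_lid (s : Module.End ℂ ℂ) (T : Module.End ℂ H) :
    conj (lidIsometry ℂ H) (TensorProduct.map s T) = s 1 • T := by
  ext x
  simp [conj_apply_apply]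

@[simp] theorem conj_rid (s : Module.End ℂ ℂ) (T : Module.End ℂ H) :
    conj (ridIsometry ℂ H) (TensorProduct.map T s) = s 1 • T := by
  ext x
  simp [conj_apply_apply]

@[simp] theorem conj_comm (S : Module.End ℂ H) (T : Module.End ℂ K) :
    conj (commIsometry ℂ H K) (TensorProduct.map S T) = TensorProduct.map T S := by
  apply TensorProduct.ext'
  intro x y
  rfl

/-! Identities between such maps, checked on tensor products of operators. -/

theorem superTensor_zero_left (Ψ : Module.End ℂ L →ₗ[ℂ] Module.End ℂ M) :
    superTensor (0 : Module.End ℂ H →ₗ[ℂ] Module.End ℂ K) Ψ = 0 := by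
  simp [superTensor]

theorem superTensor_add_left (Φ Φ' : Module.End ℂ H →ₗ[ℂ] Module.End ℂ K)
    (Ψ : Module.End ℂ L →ₗ[ℂ] Module.End ℂ M) :
    superTensor (Φ + Φ') Ψ = superTensor Φ Ψ + superTensor Φ' Ψ := by
  simp [superTensor, TensorProduct.map_add_left, LinearMap.add_comp, LinearMap.comp_add]

theorem superTensor_id_id :
    superTensor (LinearMap.id : Module.End ℂ H →ₗ[ℂ] Module.End ℂ H)
      (LinearMap.id : Module.End ℂ K →ₗ[ℂ] Module.End ℂ K) = LinearMap.id :=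
  ext₂ fun S T => by simp

theorem superTensor_comp_superTensor
    (Φ : Module.End ℂ H →ₗ[ℂ] Module.End ℂ K) (Φ' : Module.End ℂ K →ₗ[ℂ] Module.End ℂ L)
    (Ψ : Module.End ℂ H' →ₗ[ℂ] Module.End ℂ K') (Ψ' : Module.End ℂ K' →ₗ[ℂ] Module.End ℂ L') :
    superTensor Φ' Ψ' ∘ₗ superTensor Φ Ψ = superTensor (Φ' ∘ₗ Φ) (Ψ' ∘ₗ Ψ) :=
  ext₂ fun S T => by simp

theorem assoc_naturality
    (Φ : Module.End ℂ H →ₗ[ℂ] Module.End ℂ H') (Ψ : Module.End ℂ K →ₗ[ℂ] Module.End ℂ K')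
    (Θ : Module.End ℂ L →ₗ[ℂ] Module.End ℂ L') :
    conj (assocIsometry ℂ H' K' L') ∘ₗ superTensor (superTensor Φ Ψ) Θ =
      superTensor Φ (superTensor Ψ Θ) ∘ₗ conj (assocIsometry ℂ H K L) :=
  ext₃ fun S T U => by simp

theorem lid_naturality (Φ : Module.End ℂ H →ₗ[ℂ] Module.End ℂ K) :
    conj (lidIsometry ℂ K) ∘ₗ superTensor LinearMap.id Φ = Φ ∘ₗ conj (lidIsometry ℂ H) :=
  ext₂ fun S T => by simp

theorem rid_naturality (Φ : Module.End ℂ H →ₗ[ℂ] Module.End ℂ K) :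
    conj (ridIsometry ℂ K) ∘ₗ superTensor Φ LinearMap.id = Φ ∘ₗ conj (ridIsometry ℂ H) :=
  ext₂ fun S T => by simp

theorem comm_naturality (Φ : Module.End ℂ H →ₗ[ℂ] Module.End ℂ K)
    (Ψ : Module.End ℂ L →ₗ[ℂ] Module.End ℂ M) :
    conj (commIsometry ℂ K M) ∘ₗ superTensor Φ Ψ =
      superTensor Ψ Φ ∘ₗ conj (commIsometry ℂ H L) :=
  ext₂ fun S T => by simp

theorem pentagon_identity :
    (superTensor LinearMap.id (conj (assocIsometry ℂ K L M)) ∘ₗ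
      conj (assocIsometry ℂ H (K ⊗[ℂ] L) M)) ∘ₗ
        superTensor (conj (assocIsometry ℂ H K L)) LinearMap.id =
      conj (assocIsometry ℂ H K (L ⊗[ℂ] M)) ∘ₗ conj (assocIsometry ℂ (H ⊗[ℂ] K) L M) :=
  ext₄ fun S T U W => by simp

theorem triangle_identity :
    superTensor LinearMap.id (conj (lidIsometry ℂ K)) ∘ₗ conj (assocIsometry ℂ H ℂ K) =
      superTensor (conj (ridIsometry ℂ H)) LinearMap.id :=
  ext₃ fun S T U => by simp [TensorProduct.map_smul_left, TensorProduct.map_smul_right]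

theorem hexagon_identity :
    (conj (assocIsometry ℂ K L H) ∘ₗ conj (commIsometry ℂ H (K ⊗[ℂ] L))) ∘ₗ
        conj (assocIsometry ℂ H K L) =
      (superTensor LinearMap.id (conj (commIsometry ℂ H L)) ∘ₗ conj (assocIsometry ℂ K H L)) ∘ₗ
        superTensor (conj (commIsometry ℂ H K)) LinearMap.id :=
  ext₃ fun S T U => by simp

theorem hexagon_identity' :
    (conj (assocIsometry ℂ L H K).symm ∘ₗ conj (commIsometry ℂ (H ⊗[ℂ] K) L)) ∘ₗ
        conj (assocIsometry ℂ H K L).symm =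
      (superTensor (conj (commIsometry ℂ H L)) LinearMap.id ∘ₗ
        conj (assocIsometry ℂ H L K).symm) ∘ₗ
        superTensor LinearMap.id (conj (commIsometry ℂ K L)) :=
  ext₃' fun S T U => by simp

theorem comm_comm : conj (commIsometry ℂ K H) ∘ₗ conj (commIsometry ℂ H K) = LinearMap.id :=
  ext₂ fun S T => by simp

theorem superTensor_eq_comp (Φ : Module.End ℂ H →ₗ[ℂ] Module.End ℂ K)
    (Ψ : Module.End ℂ L →ₗ[ℂ] Module.End ℂ M) :
    superTensor Φ Ψ = conj (commIsometry ℂ M K) ∘ₗ superTensor Ψ LinearMap.id ∘ₗ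
      conj (commIsometry ℂ K L) ∘ₗ superTensor Φ LinearMap.id :=
  ext₂ fun S T => by simp

theorem superTensor_superTensor_id (Φ : Module.End ℂ H →ₗ[ℂ] Module.End ℂ K) :
    superTensor (superTensor Φ (LinearMap.id : Module.End ℂ L →ₗ[ℂ] Module.End ℂ L))
        (LinearMap.id : Module.End ℂ M →ₗ[ℂ] Module.End ℂ M) =
      conj (assocIsometry ℂ K L M).symm ∘ₗ superTensor Φ LinearMap.id ∘ₗ
        conj (assocIsometry ℂ H L M) :=
  ext₃ fun S T U => by simp

theorem isPositive_conj (e : H ≃ₗᵢ[ℂ] K) {X : Module.End ℂ H} (hX : X.IsPositive) :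
    (conj e X).IsPositive := by
  rw [conj_eq_sandwich]
  exact hX.conj_adjoint _

/-- The linear map `End ℂ → End H` sending `1` to the identity operator: the state on `H` with
density operator the identity. (`End ℂ` is identified with `ℂ` by evaluation at `1`.) -/
def identityState (H : Type*) [NormedAddCommGroup H] [InnerProductSpace ℂ H] :
    Module.End ℂ ℂ →ₗ[ℂ] Module.End ℂ H where
  toFun s := s 1 • LinearMap.id
  map_add' s t := by rw [LinearMap.add_apply, add_smul]
  map_smul' c s := by rw [LinearMap.smul_apply, smul_assoc, RingHom.id_apply]

/-- The linear map `End H → End ℂ` sending an operator to (multiplication by) its trace. -/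
def traceEffect (H : Type*) [NormedAddCommGroup H] [InnerProductSpace ℂ H] :
    Module.End ℂ H →ₗ[ℂ] Module.End ℂ ℂ where
  toFun S := LinearMap.trace ℂ H S • LinearMap.id
  map_add' S T := by rw [map_add, add_smul]
  map_smul' c S := by rw [map_smul, smul_assoc, RingHom.id_apply]

theorem adjoint_toSpanSingleton (e : H) :
    LinearMap.adjoint (LinearMap.toSpanSingleton ℂ H e) = innerₛₗ ℂ e := by
  symm
  rw [LinearMap.eq_adjoint_iff]
  intro x y
  simp [inner_smul_right]

theorem identityState_eq_sum :
    identityState H =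
      ∑ i, sandwich (LinearMap.toSpanSingleton ℂ H (stdOrthonormalBasis ℂ H i)) := by
  apply LinearMap.ext
  intro s
  apply LinearMap.ext
  intro x
  have hs (c : ℂ) : s c = c * s 1 := by
    rw [← smul_eq_mul, ← map_smul, smul_eq_mul, mul_one]
  rw [LinearMap.sum_apply, LinearMap.sum_apply]
  simp only [sandwich_apply, adjoint_toSpanSingleton, LinearMap.comp_apply, innerₛₗ_apply_apply,
    LinearMap.toSpanSingleton_apply]
  calc s 1 • x = s 1 • ∑ i, inner ℂ (stdOrthonormalBasis ℂ H i) x • stdOrthonormalBasis ℂ H i := by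
        rw [(stdOrthonormalBasis ℂ H).sum_repr']
    _ = _ := by
        rw [Finset.smul_sum]
        refine Finset.sum_congr rfl fun i _ => ?_
        rw [hs (inner ℂ (stdOrthonormalBasis ℂ H i) x), smul_smul, mul_comm]

theorem traceEffect_eq_sum :
    traceEffect H = ∑ i, sandwich (innerₛₗ ℂ (stdOrthonormalBasis ℂ H i)) := by
  apply LinearMap.ext
  intro S
  apply LinearMap.ext_ring
  have hadj (e : H) : LinearMap.adjoint (innerₛₗ ℂ e) = LinearMap.toSpanSingleton ℂ H e := by
    rw [← adjoint_toSpanSingleton, LinearMap.adjoint_adjoint]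
  rw [LinearMap.sum_apply, LinearMap.sum_apply]
  simp only [sandwich_apply, hadj, LinearMap.comp_apply, innerₛₗ_apply_apply,
    LinearMap.toSpanSingleton_apply, one_smul]
  rw [← LinearMap.trace_eq_sum_inner S (stdOrthonormalBasis ℂ H)]
  exact mul_one _

end

end SuperOp

/-! ## Finite-dimensional Hilbert spaces and completely positive maps -/

/-- A finite-dimensional complex Hilbert space. -/
structure Quant where
  carrier : Type
  [normedAddCommGroup : NormedAddCommGroup carrier]
  [innerProductSpace : InnerProductSpace ℂ carrier]
  [finiteDimensional : FiniteDimensional ℂ carrier]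

namespace Quant

open SuperOp

instance : CoeSort Quant Type := ⟨Quant.carrier⟩

attribute [instance] normedAddCommGroup innerProductSpace finiteDimensional

/-- A linear map between operator spaces is completely positive if all its amplifications
`Φ ⊗ id_E`, for `E` a finite-dimensional Hilbert space, send positive semidefinite operators to
positive semidefinite operators. -/
def IsCP {H K : Quant} (Φ : Module.End ℂ H →ₗ[ℂ] Module.End ℂ K) : Prop :=
  ∀ (E : Quant) (X : Module.End ℂ (H ⊗[ℂ] E)), X.IsPositive →
    (superTensor Φ (LinearMap.id : Module.End ℂ E →ₗ[ℂ] Module.End ℂ E) X).IsPositive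

variable {H K L M : Quant}

theorem isCP_id : IsCP (LinearMap.id : Module.End ℂ H →ₗ[ℂ] Module.End ℂ H) := by
  intro E X hX
  rw [superTensor_id_id]
  exact hX

theorem IsCP.comp {Ψ : Module.End ℂ K →ₗ[ℂ] Module.End ℂ L}
    {Φ : Module.End ℂ H →ₗ[ℂ] Module.End ℂ K} (hΨ : IsCP Ψ) (hΦ : IsCP Φ) : IsCP (Ψ ∘ₗ Φ) := by
  intro E X hX
  rw [← LinearMap.id_comp (LinearMap.id : Module.End ℂ E →ₗ[ℂ] Module.End ℂ E),
    ← superTensor_comp_superTensor]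
  exact hΨ E _ (hΦ E X hX)

theorem isCP_sandwich (A : H →ₗ[ℂ] K) : IsCP (sandwich A) := by
  intro E X hX
  rw [sandwich_superTensor_id, sandwich_apply]
  exact hX.conj_adjoint _

theorem isCP_conj (e : H ≃ₗᵢ[ℂ] K) : IsCP (conj e) := by
  rw [conj_eq_sandwich]
  exact isCP_sandwich _

theorem isCP_zero : IsCP (0 : Module.End ℂ H →ₗ[ℂ] Module.End ℂ K) := by
  intro E X _
  rw [superTensor_zero_left]
  exact LinearMap.isPositive_zero

theorem IsCP.add {Φ Ψ : Module.End ℂ H →ₗ[ℂ] Module.End ℂ K} (hΦ : IsCP Φ) (hΨ : IsCP Ψ) :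
    IsCP (Φ + Ψ) := by
  intro E X hX
  rw [superTensor_add_left]
  exact (hΦ E X hX).add (hΨ E X hX)

theorem isCP_sum {ι : Type*} (s : Finset ι) (Φ : ι → Module.End ℂ H →ₗ[ℂ] Module.End ℂ K)
    (h : ∀ i ∈ s, IsCP (Φ i)) : IsCP (∑ i ∈ s, Φ i) := by
  classical
  induction s using Finset.induction_on with
  | empty => simpa using isCP_zero
  | insert i s hi ih =>
    rw [Finset.sum_insert hi]
    exact (h i (Finset.mem_insert_self i s)).add
      (ih fun j hj => h j (Finset.mem_insert_of_mem hj))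

/-! ### The category structure -/

/-- Completely positive maps from `H` to `K`, as linear maps from the operators on `H` to the
operators on `K`. -/
@[ext] structure Hom (H K : Quant) where
  toLinearMap : Module.End ℂ H →ₗ[ℂ] Module.End ℂ K
  isCP : IsCP toLinearMap

instance : Category Quant where
  Hom := Hom
  id _ := ⟨LinearMap.id, isCP_id⟩
  comp f g := ⟨g.toLinearMap ∘ₗ f.toLinearMap, g.isCP.comp f.isCP⟩

@[ext] theorem hom_ext {f g : H ⟶ K} (h : f.toLinearMap = g.toLinearMap) : f = g :=
  Hom.ext h

@[simp] theorem id_toLinearMap (H : Quant) : Hom.toLinearMap (𝟙 H) = LinearMap.id := rfl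

@[simp] theorem comp_toLinearMap (f : H ⟶ K) (g : K ⟶ L) :
    Hom.toLinearMap (f ≫ g) = g.toLinearMap ∘ₗ f.toLinearMap := rfl

/-- The isomorphism of systems given by conjugation by a unitary. -/
def isoOfUnitary (e : H ≃ₗᵢ[ℂ] K) : H ≅ K where
  hom := ⟨conj e, isCP_conj e⟩
  inv := ⟨conj e.symm, isCP_conj e.symm⟩
  hom_inv_id := by
    apply hom_ext
    ext S x
    simp [conj_apply_apply]
  inv_hom_id := by
    apply hom_ext
    ext S x
    simp [conj_apply_apply]

/-! ### The symmetric monoidal structure -/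

/-- The tensor product of Hilbert spaces. -/
def tensorSys (H K : Quant) : Quant := ⟨H ⊗[ℂ] K⟩

/-- The one-dimensional Hilbert space. -/
def unitSys : Quant := ⟨ℂ⟩

theorem IsCP.tensor_id {Φ : Module.End ℂ H →ₗ[ℂ] Module.End ℂ K} (hΦ : IsCP Φ) (L : Quant) :
    IsCP (H := tensorSys H L) (K := tensorSys K L)
      (superTensor Φ (LinearMap.id : Module.End ℂ L →ₗ[ℂ] Module.End ℂ L)) := by
  intro E X hX
  have h := isPositive_conj (assocIsometry ℂ K L E).symm
    (hΦ (tensorSys L E) _ (isPositive_conj (assocIsometry ℂ H L E) hX))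
  have e := LinearMap.congr_fun (superTensor_superTensor_id (L := L) (M := E) Φ) X
  exact e ▸ h

theorem IsCP.tensor {Φ : Module.End ℂ H →ₗ[ℂ] Module.End ℂ K} (hΦ : IsCP Φ)
    {Ψ : Module.End ℂ L →ₗ[ℂ] Module.End ℂ M} (hΨ : IsCP Ψ) :
    IsCP (H := tensorSys H L) (K := tensorSys K M) (superTensor Φ Ψ) := by
  rw [superTensor_eq_comp]
  exact (isCP_conj (H := tensorSys M K) (K := tensorSys K M) _).comp
    ((hΨ.tensor_id K).comp ((isCP_conj (H := tensorSys K L) (K := tensorSys L K) _).comp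
      (hΦ.tensor_id L)))

/-- The tensor product of completely positive maps. -/
def tensorMap (f : H ⟶ K) (g : L ⟶ M) : tensorSys H L ⟶ tensorSys K M :=
  ⟨superTensor f.toLinearMap g.toLinearMap, f.isCP.tensor g.isCP⟩

instance : MonoidalCategoryStruct Quant where
  tensorObj := tensorSys
  whiskerLeft H _ _ f := tensorMap (𝟙 H) f
  whiskerRight f H := tensorMap f (𝟙 H)
  tensorHom f g := tensorMap f g
  tensorUnit := unitSys
  associator H K L := isoOfUnitary (H := tensorSys (tensorSys H K) L)
    (K := tensorSys H (tensorSys K L)) (assocIsometry ℂ H K L)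
  leftUnitor H := isoOfUnitary (H := tensorSys unitSys H) (lidIsometry ℂ H)
  rightUnitor H := isoOfUnitary (H := tensorSys H unitSys) (ridIsometry ℂ H)

instance : MonoidalCategory Quant :=
  MonoidalCategory.ofTensorHom
    (id_tensorHom_id := fun _ _ => hom_ext superTensor_id_id)
    (id_tensorHom := fun _ _ _ _ => rfl)
    (tensorHom_id := fun _ _ => rfl)
    (tensorHom_comp_tensorHom := fun _ _ _ _ => hom_ext (superTensor_comp_superTensor _ _ _ _))
    (associator_naturality := fun _ _ _ => hom_ext (assoc_naturality _ _ _))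
    (leftUnitor_naturality := fun _ => hom_ext (lid_naturality _))
    (rightUnitor_naturality := fun _ => hom_ext (rid_naturality _))
    (pentagon := fun _ _ _ _ => hom_ext pentagon_identity)
    (triangle := fun _ _ => hom_ext triangle_identity)

instance : BraidedCategory Quant where
  braiding H K := isoOfUnitary (H := tensorSys H K) (K := tensorSys K H) (commIsometry ℂ H K)
  braiding_naturality_right _ _ _ _ := hom_ext (comm_naturality _ _)
  braiding_naturality_left _ _ := hom_ext (comm_naturality _ _)
  hexagon_forward _ _ _ := hom_ext hexagon_identity
  hexagon_reverse _ _ _ := hom_ext hexagon_identity'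

instance : SymmetricCategory Quant where
  symmetry _ _ := hom_ext comm_comm

/-! ### Completely mixed states and discarding effects -/

theorem isCP_identityState (H : Quant) : IsCP (H := unitSys) (K := H) (identityState H) := by
  rw [identityState_eq_sum]
  exact isCP_sum (H := unitSys) (K := H) _ _ fun i _ => isCP_sandwich (H := unitSys) (K := H) _

theorem isCP_traceEffect (H : Quant) : IsCP (H := H) (K := unitSys) (traceEffect H) := by
  rw [traceEffect_eq_sum]
  exact isCP_sum (H := H) (K := unitSys) _ _ fun i _ => isCP_sandwich (H := H) (K := unitSys) _

/-- The completely mixed state on `H`, with density operator the identity. -/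
def mixedState (H : Quant) : 𝟙_ Quant ⟶ H := ⟨identityState H, isCP_identityState H⟩

/-- The discarding effect on `H`, given by the trace. -/
def discardEffect (H : Quant) : H ⟶ 𝟙_ Quant := ⟨traceEffect H, isCP_traceEffect H⟩

/-- The property of being a nonzero Hilbert space. -/
def nonzero : ObjectProperty Quant := fun H => Nontrivial H

instance : nonzero.IsMonoidal where
  prop_unit := inferInstanceAs (Nontrivial ℂ)
  prop_tensor H K hH hK := by
    have : Nontrivial H := hH
    have : Nontrivial K := hK
    exact inferInstanceAs (Nontrivial (H ⊗[ℂ] K))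

/-- The completely mixed states of all nonzero Hilbert spaces. -/
def mixedStates (H : {H : Quant // nonzero H}) : 𝟙_ Quant ⟶ H.1 := mixedState H.1

/-- The discarding effects of all nonzero Hilbert spaces. -/
def discardEffects (H : {H : Quant // nonzero H}) : H.1 ⟶ 𝟙_ Quant := discardEffect H.1

end Quant

/-- The full symmetric monoidal subcategory of `Quant` on the nonzero Hilbert spaces. -/
abbrev NonzeroQuant := Quant.nonzero.FullSubcategory

namespace NonzeroQuant

/-- The completely mixed state on each object of `NonzeroQuant`. -/
def mixedStates (H : NonzeroQuant) : 𝟙_ NonzeroQuant ⟶ H :=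
  ObjectProperty.homMk (Quant.mixedState H.obj)

/-- The discarding effect on each object of `NonzeroQuant`. -/
def discardEffects (H : NonzeroQuant) : H ⟶ 𝟙_ NonzeroQuant :=
  ObjectProperty.homMk (Quant.discardEffect H.obj)

end NonzeroQuant

end

/-! ### Unitary freedom of Kraus decompositions -/

open CategoryTheory MonoidalCategory TensorProduct

noncomputable section

/-! Every completely positive map is a finite sum of maps `S ↦ A S A†`. The key claim is that a map
with a single Kraus operator is both pure and copure.

For purity, a mixed state tensored with an identity is `∑ i, sandwich (F i)`, where the `F i` are
isometries with mutually orthogonal ranges filling the target. Let `a` and `b` with Kraus operators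
`A j` and `B l` form a square against one operator `G`. Then `G ∘ A j` and `B l ∘ F i` are two Kraus
families of the same map. After padding to a common index set, they differ by a unitary matrix.
Rotating the `A j` by this unitary gives another Kraus family `D (l, i)` of `a`, now with `G ∘ D (l,
i) = B l ∘ F i`. The operators `E l = ∑ i, D (l, i) ∘ (F i)†` satisfy `E l ∘ F i = D (l, i)` and `G
∘ E l = B l`, so they are Kraus operators of a diagonal. Copurity is the same argument with the
adjoints `(G i)†` of such isometries on the right of the square.

Purification and copurification follow by stacking the Kraus operators of a map into a single
operator with an ancilla (Stinespring). The factorisation systems are then formal: `⊘` is a Galois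
connection whose classes are closed under composition with isomorphisms and under tensoring with
objects. Since the lifts and ancillas only involve objects already in the subcategory, everything
restricts to nonzero spaces. -/

/-- Two families of vectors with the same Gram matrix differ by a linear isometry. -/
theorem exists_linearIsometry_of_inner_eq {I V : Type*} [NormedAddCommGroup V]
    [InnerProductSpace ℂ V] [FiniteDimensional ℂ V] (v w : I → V)
    (h : ∀ i j, inner ℂ (v i) (v j) = inner ℂ (w i) (w j)) :
    ∃ U : V →ₗᵢ[ℂ] V, ∀ i, U (v i) = w i := by
  let P := Finsupp.linearCombination ℂ v
  let Q := Finsupp.linearCombination ℂ w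
  have hin (c : I →₀ ℂ) : inner ℂ (P c) (P c) = inner ℂ (Q c) (Q c) := by
    simp only [P, Q, Finsupp.linearCombination_apply, Finsupp.sum, sum_inner, inner_sum,
      inner_smul_left, inner_smul_right, h]
  have hnorm (c : I →₀ ℂ) : ‖Q c‖ = ‖P c‖ := by
    rw [@norm_eq_sqrt_re_inner ℂ, @norm_eq_sqrt_re_inner ℂ, hin]
  have hker : LinearMap.ker P ≤ LinearMap.ker Q := fun c hc => by
    rw [LinearMap.mem_ker] at hc ⊢
    rw [← norm_eq_zero, hnorm, hc, norm_zero]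
  -- The assignment `∑ c i • v i ↦ ∑ c i • w i` is well defined and isometric because equal Gram
  -- matrices give equal norms.
  let L : LinearMap.range P →ₗ[ℂ] V :=
    (LinearMap.ker P).liftQ Q hker ∘ₗ P.quotKerEquivRange.symm.toLinearMap
  have hL (c : I →₀ ℂ) : L ⟨P c, c, rfl⟩ = Q c := by
    have : P.quotKerEquivRange.symm ⟨P c, c, rfl⟩ = (LinearMap.ker P).mkQ c :=
      P.quotKerEquivRange_symm_apply_image c _
    simp only [L, LinearMap.comp_apply, LinearEquiv.coe_coe, this]
    rfl
  let Li : LinearMap.range P →ₗᵢ[ℂ] V := ⟨L, by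
    rintro ⟨_, c, rfl⟩
    rw [hL]
    exact hnorm c⟩
  refine ⟨Li.extend, fun i => ?_⟩
  have hP : P (Finsupp.single i 1) = v i := by simp [P]
  have hQ : Q (Finsupp.single i 1) = w i := by simp [Q]
  rw [← hP, ← hQ, ← hL]
  exact Li.extend_apply ⟨P (Finsupp.single i 1), _, rfl⟩

namespace SuperOp

set_option linter.unusedSectionVars false

variable {H K L N : Type*}
  [NormedAddCommGroup H] [InnerProductSpace ℂ H] [FiniteDimensional ℂ H]
  [NormedAddCommGroup K] [InnerProductSpace ℂ K] [FiniteDimensional ℂ K]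
  [NormedAddCommGroup L] [InnerProductSpace ℂ L] [FiniteDimensional ℂ L]
  [AddCommGroup N] [Module ℂ N]

theorem sandwich_comp_sandwich (B : K →ₗ[ℂ] L) (A : H →ₗ[ℂ] K) :
    sandwich B ∘ₗ sandwich A = sandwich (B ∘ₗ A) := by
  apply LinearMap.ext
  intro S
  simp only [LinearMap.comp_apply, sandwich_apply, LinearMap.adjoint_comp, LinearMap.comp_assoc]

theorem comp_sum {M : Type*} [AddCommGroup M] [Module ℂ M] {J P : Type*} [Fintype J]
    [AddCommGroup P] [Module ℂ P] (f : N →ₗ[ℂ] P) (g : J → M →ₗ[ℂ] N) :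
    f ∘ₗ ∑ j, g j = ∑ j, f ∘ₗ g j := by
  apply LinearMap.ext
  intro x
  simp

theorem sum_comp {M : Type*} [AddCommGroup M] [Module ℂ M] {J P : Type*} [Fintype J]
    [AddCommGroup P] [Module ℂ P] (f : J → N →ₗ[ℂ] P) (g : M →ₗ[ℂ] N) :
    (∑ j, f j) ∘ₗ g = ∑ j, f j ∘ₗ g := by
  apply LinearMap.ext
  intro x
  simp

theorem sandwich_zero : sandwich (0 : H →ₗ[ℂ] K) = 0 := by
  apply LinearMap.ext
  intro S
  simp [sandwich_apply]

/-- The operator `x ↦ ⟪b, x⟫ a`. -/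
def ketBra (a : K) (b : H) : H →ₗ[ℂ] K := (InnerProductSpace.rankOne ℂ a b).toLinearMap

theorem ketBra_apply (a : K) (b x : H) : ketBra a b x = inner ℂ b x • a := rfl

theorem sandwich_ketBra_apply (A : H →ₗ[ℂ] K) (a b : H) (x : K) :
    sandwich A (ketBra a b) x = inner ℂ (A b) x • A a := by
  simp only [sandwich_apply, LinearMap.comp_apply, ketBra_apply, map_smul,
    LinearMap.adjoint_inner_right]

/-- The matrix units of an orthonormal basis span the operators. -/
theorem ext_ketBra {ι : Type*} [Fintype ι] (b : OrthonormalBasis ι ℂ H)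
    {f g : Module.End ℂ H →ₗ[ℂ] N}
    (h : ∀ i j, f (ketBra (b i) (b j)) = g (ketBra (b i) (b j))) : f = g := by
  apply LinearMap.ext
  intro S
  have hS : S = ∑ i, ∑ j, inner ℂ (b j) (S (b i)) • ketBra (b j) (b i) := by
    apply b.toBasis.ext
    intro k
    classical
    simp only [OrthonormalBasis.coe_toBasis, LinearMap.sum_apply, LinearMap.smul_apply,
      ketBra_apply, b.inner_eq_ite]
    conv_lhs => rw [← b.sum_repr' (S (b k))]
    rw [Finset.sum_comm]
    simp
  rw [hS]
  simp only [map_sum, map_smul, h]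

/-- Unitary freedom of Kraus decompositions. -/
theorem exists_unitary_of_sum_sandwich_eq {J : Type*} [Fintype J] [DecidableEq J]
    (A B : J → H →ₗ[ℂ] K) (h : ∑ j, sandwich (A j) = ∑ j, sandwich (B j)) :
    ∃ u : Matrix J J ℂ, u ∈ Matrix.unitaryGroup J ℂ ∧ ∀ j, B j = ∑ k, u j k • A k := by
  -- All matrix coefficients at a pair `(x, y)` are collected into one vector indexed by `J`. By
  -- `hv`, the Gram matrix of these vectors depends only on the map `∑ j, sandwich (A j)`.
  let v (A : J → H →ₗ[ℂ] K) (p : H × K) : EuclideanSpace ℂ J :=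
    WithLp.toLp 2 fun j => inner ℂ p.2 (A j p.1)
  have hv (A : J → H →ₗ[ℂ] K) (p q : H × K) : inner ℂ (v A p) (v A q) =
      inner ℂ q.2 ((∑ j, sandwich (A j)) (ketBra q.1 p.1) p.2) := by
    rw [LinearMap.sum_apply, LinearMap.sum_apply, inner_sum]
    simp only [sandwich_ketBra_apply, v, PiLp.inner_apply, inner_smul_right, RCLike.inner_apply,
      inner_conj_symm]
    exact Finset.sum_congr rfl fun j _ => mul_comm _ _
  obtain ⟨U, hU⟩ := exists_linearIsometry_of_inner_eq (v A) (v B) fun p q => by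
    rw [hv, hv, h]
  let E := EuclideanSpace.basisFun J ℂ
  -- The matrix of `U` in the standard basis; its columns are orthonormal since `U` is isometric.
  let u : Matrix J J ℂ := fun j k => U (E k) j
  refine ⟨u, ?_, fun j => ?_⟩
  · rw [Matrix.mem_unitaryGroup_iff']
    ext k l
    have := U.inner_map_map (E k) (E l)
    rw [E.inner_eq_ite, PiLp.inner_apply] at this
    rw [Matrix.mul_apply, Matrix.one_apply, ← this]
    refine Finset.sum_congr rfl fun j _ => ?_
    rw [Matrix.star_apply, RCLike.inner_apply, mul_comm]
    rfl
  · apply LinearMap.ext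
    intro x
    apply ext_inner_left ℂ
    intro y
    have h1 : inner ℂ y (B j x) = U (v A (x, y)) j := by rw [hU]
    have h2 : v A (x, y) = ∑ k, v A (x, y) k • E k := by
      conv_lhs => rw [← E.sum_repr (v A (x, y))]
      rfl
    rw [h1, h2, map_sum, LinearMap.sum_apply, inner_sum]
    simp only [map_smul, LinearMap.smul_apply, inner_smul_right, WithLp.ofLp_sum, Finset.sum_apply,
      PiLp.smul_apply, smul_eq_mul]
    exact Finset.sum_congr rfl fun k _ => mul_comm _ _

/-- Converse of the unitary freedom: the cross terms cancel by orthonormality of the columns of `u`.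
It allows a Kraus family to be rotated without changing its map. -/
theorem sum_sandwich_unitary {J : Type*} [Fintype J] [DecidableEq J] {u : Matrix J J ℂ}
    (hu : u ∈ Matrix.unitaryGroup J ℂ) (A : J → H →ₗ[ℂ] K) :
    ∑ j, sandwich (∑ k, u j k • A k) = ∑ k, sandwich (A k) := by
  rw [Matrix.mem_unitaryGroup_iff'] at hu
  have hu' (k l : J) : ∑ j, star (u j k) * u j l = if k = l then 1 else 0 := by
    rw [← Matrix.one_apply, ← hu, Matrix.mul_apply]
    rfl
  refine ext_ketBra (stdOrthonormalBasis ℂ H) fun a b => LinearMap.ext fun x => ?_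
  simp only [LinearMap.sum_apply, sandwich_ketBra_apply, LinearMap.smul_apply, sum_inner,
    Finset.smul_sum, Finset.sum_mul, Finset.sum_smul, inner_smul_left, smul_smul]
  rw [Finset.sum_comm]
  have h (y z : J) : ∑ j, ((starRingEnd ℂ) (u j z) * inner ℂ (A z (stdOrthonormalBasis ℂ H b)) x *
      u j y) • A y (stdOrthonormalBasis ℂ H a) = if z = y then
        inner ℂ (A z (stdOrthonormalBasis ℂ H b)) x • A y (stdOrthonormalBasis ℂ H a) else 0 := by
    rw [← Finset.sum_smul]
    simp_rw [mul_right_comm _ (inner ℂ _ _)]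
    rw [← Finset.sum_mul]
    have := hu' z y
    simp only [RCLike.star_def] at this
    rw [this]
    split <;> simp
  refine Finset.sum_congr rfl fun y _ => ?_
  rw [Finset.sum_comm]
  simp [h]

end SuperOp

/-! ### Existence of Kraus decompositions -/

namespace Quant
open SuperOp

/-- A completely positive map has a Kraus decomposition indexed by any sufficiently large finite
type. -/
theorem IsCP.exists_kraus {H K : Quant} {Φ : Module.End ℂ H →ₗ[ℂ] Module.End ℂ K} (hΦ : IsCP Φ) :
    ∃ n : ℕ, ∀ (J : Type) [Fintype J], n ≤ Fintype.card J →
      ∃ A : J → H →ₗ[ℂ] K, Φ = ∑ j, sandwich (A j) := by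
  let e := stdOrthonormalBasis ℂ H
  -- The unnormalised maximally entangled operator. Its image under `Φ ⊗ id` is the Choi operator of
  -- `Φ`, positive by complete positivity and hence a sum of rank-one operators of vectors `y k`.
  let X : Module.End ℂ (H ⊗[ℂ] H) := ketBra (∑ i, e i ⊗ₜ e i) (∑ i, e i ⊗ₜ e i)
  have hXpos : X.IsPositive := (InnerProductSpace.isPositive_rankOne_self _).toLinearMap
  have hX : X = ∑ i, ∑ j, TensorProduct.map (ketBra (e i) (e j)) (ketBra (e i) (e j)) := by
    apply TensorProduct.ext'
    intro x y
    simp only [X, ketBra_apply, LinearMap.sum_apply, TensorProduct.map_tmul, sum_inner,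
      TensorProduct.inner_tmul, Finset.sum_smul, Finset.smul_sum, TensorProduct.smul_tmul_smul]
  have hY := hΦ H X hXpos
  have hY' := LinearMap.isPositive_toContinuousLinearMap_iff _ |>.mpr hY
  obtain ⟨n, y, hy⟩ := ContinuousLinearMap.isPositive_iff_eq_sum_rankOne.mp hY'
  let R (i) : K ⊗[ℂ] H →ₗ[ℂ] K :=
    (TensorProduct.rid ℂ K).toLinearMap ∘ₗ TensorProduct.map LinearMap.id (innerₛₗ ℂ (e i))
  have hR (i x z) : R i (x ⊗ₜ z) = inner ℂ (e i) z • x := by simp [R]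
  have hRadj (i) (w : K ⊗[ℂ] H) (x : K) : inner ℂ w (x ⊗ₜ[ℂ] e i) = inner ℂ (R i w) x := by
    induction w with
    | zero => simp
    | add a b ha hb => rw [inner_add_left, ha, hb, map_add, inner_add_left]
    | tmul a b => rw [hR, TensorProduct.inner_tmul, inner_smul_left, inner_conj_symm, mul_comm]
  -- Reshapes the vector `y k` of `K ⊗ H` into an operator, sending `e i` to the component of `y k`
  -- along `e i`.
  let A (k : Fin n) : H →ₗ[ℂ] K := e.toBasis.constr ℂ fun i => R i (y k)
  have hA (k i) : A k (e i) = R i (y k) := by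
    rw [← e.coe_toBasis]
    exact e.toBasis.constr_basis ℂ _ i
  have hΦA : Φ = ∑ k, sandwich (A k) := by
    refine ext_ketBra e fun i j => LinearMap.ext fun x => ?_
    -- The `(i, j)` block of the Choi operator is `Φ` of the matrix unit.
    have h1 : R i (superTensor Φ LinearMap.id X (x ⊗ₜ e j)) = Φ (ketBra (e i) (e j)) x := by
      rw [hX]
      simp only [map_sum, LinearMap.sum_apply, superTensor_map, TensorProduct.map_tmul, hR,
        LinearMap.id_apply, ketBra_apply, inner_smul_right, e.inner_eq_ite]
      simp
    have h2 : superTensor Φ LinearMap.id X (x ⊗ₜ e j) =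
        ∑ k, inner ℂ (y k) (x ⊗ₜ e j) • y k := by
      have := congrArg (fun T => T (x ⊗ₜ e j)) hy
      simpa using this
    rw [← h1, h2]
    simp only [map_sum, map_smul, hRadj, LinearMap.sum_apply, sandwich_ketBra_apply, hA]
  refine ⟨n, fun J _ hJ => ?_⟩
  obtain ⟨f⟩ : Nonempty (Fin n ↪ J) :=
    Function.Embedding.nonempty_of_card_le (by rwa [Fintype.card_fin])
  -- Unused indices carry the zero operator.
  refine ⟨Function.extend f A 0, ?_⟩
  rw [hΦA]
  refine Fintype.sum_of_injective f f.injective _ _ (fun j hj => ?_) fun k => ?_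
  · rw [Function.extend_apply' _ _ _ fun ⟨k, hk⟩ => hj ⟨k, hk⟩]
    exact sandwich_zero
  · rw [f.injective.extend_apply]

end Quant

/-! ### Closure properties of `⊘` and formal factorisation systems -/

namespace MonoidalLifting

universe v u w

variable {V : Type u} [Category.{v} V] [MonoidalCategory V]

theorem TensorLifts.comp_left {X Y T Z W : V} {f : X ⟶ Y} {f' : Y ⟶ T} {g : Z ⟶ W}
    (h : TensorLifts f g) (h' : TensorLifts f' g) : TensorLifts (f ≫ f') g := fun A B => by
  have := h A B
  have := h' A B
  rw [comp_whiskerRight]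
  infer_instance

theorem TensorLifts.comp_right {X Y T Z W : V} {f : X ⟶ Y} {g : Z ⟶ W} {g' : W ⟶ T}
    (h : TensorLifts f g) (h' : TensorLifts f g') : TensorLifts f (g ≫ g') := fun A B => by
  have := h A B
  have := h' A B
  rw [comp_whiskerRight]
  infer_instance

theorem tensorLifts_of_isIso_left {X Y Z W : V} (f : X ⟶ Y) [IsIso f] (g : Z ⟶ W) :
    TensorLifts f g := fun _ _ => inferInstance

theorem tensorLifts_of_isIso_right {X Y Z W : V} (f : X ⟶ Y) (g : Z ⟶ W) [IsIso g] :
    TensorLifts f g := fun _ _ => inferInstance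

/-- Up to associators, tensoring with `T` and then `A` is tensoring with `T ⊗ A`, and `⊘` already
quantifies over all objects. -/
theorem TensorLifts.whiskerRight_left {X Y Z W : V} {f : X ⟶ Y} {g : Z ⟶ W}
    (h : TensorLifts f g) (T : V) : TensorLifts (f ▷ T) g := fun A B => by
  have := h (T ⊗ A) B
  have e : f ▷ T ▷ A = (α_ X T A).hom ≫ f ▷ (T ⊗ A) ≫ (α_ Y T A).inv := by simp
  rw [e]
  infer_instance

theorem TensorLifts.whiskerRight_right {X Y Z W : V} {f : X ⟶ Y} {g : Z ⟶ W}
    (h : TensorLifts f g) (T : V) : TensorLifts f (g ▷ T) := fun A B => by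
  have := h A (T ⊗ B)
  have e : g ▷ T ▷ B = (α_ Z T B).hom ≫ g ▷ (T ⊗ B) ≫ (α_ W T B).inv := by simp
  rw [e]
  infer_instance

theorem TensorLifts.whiskerLeft_left [SymmetricCategory V] {X Y Z W : V} {f : X ⟶ Y} {g : Z ⟶ W}
    (h : TensorLifts f g) (T : V) : TensorLifts (T ◁ f) g := by
  have e : T ◁ f = (β_ T X).hom ≫ f ▷ T ≫ (β_ T Y).inv := by simp
  rw [e]
  exact (tensorLifts_of_isIso_left _ g).comp_left
    ((h.whiskerRight_left T).comp_left (tensorLifts_of_isIso_left _ g))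

/-- The triple identity of the Galois connection defined by `⊘`. -/
theorem rightTensorLift_leftTensorLift_rightTensorLift (𝒜 : MorphismProperty V) :
    rightTensorLift (leftTensorLift (rightTensorLift 𝒜)) = rightTensorLift 𝒜 := by
  ext Z W g
  exact ⟨fun hg X Y f hf => hg f fun _ _ g' hg' => hg' f hf, fun hg X Y f hf => hf g hg⟩

theorem leftTensorLift_rightTensorLift_leftTensorLift (𝒜 : MorphismProperty V) :
    leftTensorLift (rightTensorLift (leftTensorLift 𝒜)) = leftTensorLift 𝒜 := by
  ext X Y f
  exact ⟨fun hf Z W g hg => hf g fun _ _ f' hf' => hf' g hg, fun hf Z W g hg => hg f hf⟩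

/-- In a purification, the map before `p` is a completely mixed state tensored with an object and
composed with a unitor, hence mixing. -/
theorem HasPurification.isSymmetricMonoidalWFS [SymmetricCategory V] {ι : Type w} {C : ι → V}
    {mix : ∀ i, 𝟙_ V ⟶ C i}
    (h : HasPurification mix) :
    IsSymmetricMonoidalWFS (mixingMorphisms mix) (pureMorphisms mix) where
  factorisation X Y f := by
    obtain ⟨i, p, hp, rfl⟩ := h f
    refine ⟨_, (ρ_ X).inv ≫ X ◁ mix i, p, fun Z W g hg => ?_, hp, Category.assoc _ _ _⟩
    exact (tensorLifts_of_isIso_left _ g).comp_left ((hg (mix i) ⟨i⟩).whiskerLeft_left X)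
  left_eq := rfl
  right_eq := (rightTensorLift_leftTensorLift_rightTensorLift _).symm

theorem HasCopurification.isSymmetricMonoidalWFS {ι : Type w} {C : ι → V}
    {disc : ∀ i, C i ⟶ 𝟙_ V} (h : HasCopurification disc) :
    IsSymmetricMonoidalWFS (copureMorphisms disc) (discardingMorphisms disc) where
  factorisation X Y f := by
    obtain ⟨i, c, hc, rfl⟩ := h f
    refine ⟨_, c, disc i ▷ Y ≫ (λ_ Y).hom, hc, fun Z W g hg => ?_, rfl⟩
    exact ((hg (disc i) ⟨i⟩).whiskerRight_right Y).comp_right (tensorLifts_of_isIso_right g _)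
  left_eq := (leftTensorLift_rightTensorLift_leftTensorLift _).symm
  right_eq := rfl

end MonoidalLifting

/-! ### Lifting in full subcategories -/

namespace CategoryTheory.ObjectProperty

theorem hasLiftingProperty_of_hom {𝒱 : Type*} [Category 𝒱] {P : ObjectProperty 𝒱}
    {X Y Z W : P.FullSubcategory} (f : X ⟶ Y) (g : Z ⟶ W) [HasLiftingProperty f.hom g.hom] :
    HasLiftingProperty f g where
  sq_hasLift {a b} sq := by
    have sq' : CommSq a.hom f.hom g.hom b.hom := ⟨congrArg (·.hom) sq.w⟩
    exact ⟨⟨{ l := homMk sq'.lift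
              fac_left := InducedCategory.hom_ext sq'.fac_left
              fac_right := InducedCategory.hom_ext sq'.fac_right }⟩⟩

end CategoryTheory.ObjectProperty

/-! ### Kraus operators of mixed states and discarding effects -/

namespace SuperOp

set_option linter.unusedSectionVars false

variable {H K L : Type*}
  [NormedAddCommGroup H] [InnerProductSpace ℂ H] [FiniteDimensional ℂ H]
  [NormedAddCommGroup K] [InnerProductSpace ℂ K] [FiniteDimensional ℂ K]
  [NormedAddCommGroup L] [InnerProductSpace ℂ L] [FiniteDimensional ℂ L]

theorem id_superTensor_sandwich (A : H →ₗ[ℂ] K) :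
    superTensor (LinearMap.id : Module.End ℂ L →ₗ[ℂ] Module.End ℂ L) (sandwich A) =
      sandwich (TensorProduct.map LinearMap.id A) := by
  apply ext₂
  intro S T
  simp only [superTensor_map, sandwich_apply, TensorProduct.adjoint_map, LinearMap.adjoint_id,
    LinearMap.id_apply, ← TensorProduct.map_comp, LinearMap.id_comp, LinearMap.comp_id]

/-- Adjoin the `i`-th standard basis vector of `H` on the left. -/
def ketLeft (H L : Type*) [NormedAddCommGroup H] [InnerProductSpace ℂ H] [FiniteDimensional ℂ H]
    [NormedAddCommGroup L] [InnerProductSpace ℂ L]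
    (i : Fin (Module.finrank ℂ H)) : ℂ ⊗[ℂ] L →ₗ[ℂ] H ⊗[ℂ] L :=
  TensorProduct.map (LinearMap.toSpanSingleton ℂ H (stdOrthonormalBasis ℂ H i)) LinearMap.id

theorem adjoint_ketLeft (i : Fin (Module.finrank ℂ H)) :
    LinearMap.adjoint (ketLeft H L i) =
      TensorProduct.map (innerₛₗ ℂ (stdOrthonormalBasis ℂ H i)) LinearMap.id := by
  rw [ketLeft, TensorProduct.adjoint_map, adjoint_toSpanSingleton, LinearMap.adjoint_id]

/-- With `sum_ketLeft_comp_adjoint_ketLeft`, this says that `H ⊗ L` is the orthogonal direct sum of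
copies of `ℂ ⊗ L`, one per basis vector; these are the two relations the lifting arguments need. -/
theorem adjoint_ketLeft_comp_ketLeft (i j : Fin (Module.finrank ℂ H)) :
    LinearMap.adjoint (ketLeft H L i) ∘ₗ ketLeft H L j = if i = j then LinearMap.id else 0 := by
  rw [adjoint_ketLeft]
  apply TensorProduct.ext'
  intro x y
  simp only [ketLeft, LinearMap.comp_apply, TensorProduct.map_tmul, innerₛₗ_apply_apply,
    LinearMap.toSpanSingleton_apply, inner_smul_right, OrthonormalBasis.inner_eq_ite]
  split <;> simp

theorem sum_ketLeft_comp_adjoint_ketLeft :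
    ∑ i, ketLeft H L i ∘ₗ LinearMap.adjoint (ketLeft H L i) = LinearMap.id := by
  apply TensorProduct.ext'
  intro x y
  simp only [adjoint_ketLeft]
  simp only [ketLeft, LinearMap.sum_apply, LinearMap.comp_apply, TensorProduct.map_tmul,
    innerₛₗ_apply_apply, LinearMap.toSpanSingleton_apply,
    LinearMap.id_apply, ← TensorProduct.sum_tmul, OrthonormalBasis.sum_repr']

theorem superTensor_identityState_id :
    superTensor (identityState H) (LinearMap.id : Module.End ℂ L →ₗ[ℂ] Module.End ℂ L) =
      ∑ i, sandwich (ketLeft H L i) := by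
  apply ext₂
  intro S T
  simp only [ketLeft, ← sandwich_superTensor_id, LinearMap.sum_apply, superTensor_map,
    identityState_eq_sum]
  exact map_sum ((TensorProduct.mapBilinear (.id ℂ) H L H L).flip T) _ _

theorem superTensor_traceEffect_id :
    superTensor (traceEffect H) (LinearMap.id : Module.End ℂ L →ₗ[ℂ] Module.End ℂ L) =
      ∑ i, sandwich (LinearMap.adjoint (ketLeft H L i)) := by
  apply ext₂
  intro S T
  simp only [adjoint_ketLeft, ← sandwich_superTensor_id, LinearMap.sum_apply, superTensor_map,
    traceEffect_eq_sum]
  exact map_sum ((TensorProduct.mapBilinear (.id ℂ) ℂ L ℂ L).flip T) _ _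

theorem id_superTensor_identityState :
    superTensor (LinearMap.id : Module.End ℂ L →ₗ[ℂ] Module.End ℂ L) (identityState H) =
      ∑ i, sandwich (TensorProduct.map LinearMap.id
        (LinearMap.toSpanSingleton ℂ H (stdOrthonormalBasis ℂ H i))) := by
  apply ext₂
  intro S T
  simp only [← id_superTensor_sandwich, LinearMap.sum_apply, superTensor_map,
    identityState_eq_sum]
  exact map_sum (TensorProduct.mapBilinear (.id ℂ) L H L H S) _ _

end SuperOp

/-! ### Diagonal lifts, purification and copurification in `Quant` -/

namespace Quant
open SuperOp MonoidalLifting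

/-- The completely positive map `S ↦ A S A†`. -/
def ofKraus {H K : Quant} (A : H →ₗ[ℂ] K) : H ⟶ K := ⟨sandwich A, isCP_sandwich A⟩

theorem isCP_sum_sandwich {H K : Quant} {J : Type*} [Fintype J] (A : J → H →ₗ[ℂ] K) :
    IsCP (∑ j, sandwich (A j)) :=
  isCP_sum _ _ fun _ _ => isCP_sandwich _

/-- Lifting an isometric decomposition against a single Kraus operator. -/
theorem exists_lift_sandwich {X Y Z W : Quant} {ι : Type} [Fintype ι] [DecidableEq ι] [Nonempty ι]
    (F : ι → X →ₗ[ℂ] Y)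
    (hF : ∀ i j, LinearMap.adjoint (F i) ∘ₗ F j = if i = j then LinearMap.id else 0)
    (hF' : ∑ i, F i ∘ₗ LinearMap.adjoint (F i) = LinearMap.id) (G : Z →ₗ[ℂ] W)
    {a : Module.End ℂ X →ₗ[ℂ] Module.End ℂ Z} {b : Module.End ℂ Y →ₗ[ℂ] Module.End ℂ W}
    (ha : IsCP a) (hb : IsCP b) (h : sandwich G ∘ₗ a = b ∘ₗ ∑ i, sandwich (F i)) :
    ∃ l : Module.End ℂ Y →ₗ[ℂ] Module.End ℂ Z, IsCP l ∧
      l ∘ₗ ∑ i, sandwich (F i) = a ∧ sandwich G ∘ₗ l = b := by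
  obtain ⟨n, hn⟩ := ha.exists_kraus
  obtain ⟨m, hm⟩ := hb.exists_kraus
  -- The operators `B l ∘ F i` are indexed by pairs, so `a` is given the same index type; `ι` being
  -- nonempty makes it large enough.
  obtain ⟨A, rfl⟩ := hn (Fin (max n m) × ι) (by
    rw [Fintype.card_prod, Fintype.card_fin]
    exact (le_max_left n m).trans (Nat.le_mul_of_pos_right _ Fintype.card_pos))
  obtain ⟨B, rfl⟩ := hm (Fin (max n m)) (by simp)
  obtain ⟨u, hu, hBA⟩ := exists_unitary_of_sum_sandwich_eq (fun j => G ∘ₗ A j)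
    (fun j => B j.1 ∘ₗ F j.2) (by
      refine Eq.trans ?_ (h.trans ?_)
      · simp only [comp_sum, sandwich_comp_sandwich]
      · rw [sum_comp, Fintype.sum_prod_type]
        simp only [comp_sum, sandwich_comp_sandwich])
  let D (j) : X →ₗ[ℂ] Z := ∑ k, u j k • A k
  have hGD (j) : G ∘ₗ D j = B j.1 ∘ₗ F j.2 := by
    simp only [D, hBA, comp_sum, LinearMap.comp_smul]
  -- The unique operator whose restriction along each `F i` is `D (l, i)`.
  let E (l) : Y →ₗ[ℂ] Z := ∑ i, D (l, i) ∘ₗ LinearMap.adjoint (F i)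
  have hEF (l i) : E l ∘ₗ F i = D (l, i) := by
    simp only [E, sum_comp, LinearMap.comp_assoc, hF]
    rw [Finset.sum_eq_single i]
    · simp
    · intro j _ hj
      simp [hj]
    · simp
  have hGE (l) : G ∘ₗ E l = B l := by
    simp only [E, comp_sum, ← LinearMap.comp_assoc, hGD]
    simp only [LinearMap.comp_assoc, ← comp_sum, hF', LinearMap.comp_id]
  refine ⟨∑ l, sandwich (E l), isCP_sum_sandwich E, ?_, ?_⟩
  · rw [← sum_sandwich_unitary hu A, Fintype.sum_prod_type, sum_comp]
    simp only [comp_sum, sandwich_comp_sandwich, hEF, D]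
  · simp only [comp_sum, sandwich_comp_sandwich, hGE]

/-- Lifting a single Kraus operator against a coisometric decomposition. -/
theorem exists_sandwich_lift {X Y Z W : Quant} {ι : Type} [Fintype ι] [DecidableEq ι] [Nonempty ι]
    (F : X →ₗ[ℂ] Y) (G : ι → W →ₗ[ℂ] Z)
    (hG : ∀ i j, LinearMap.adjoint (G i) ∘ₗ G j = if i = j then LinearMap.id else 0)
    (hG' : ∑ i, G i ∘ₗ LinearMap.adjoint (G i) = LinearMap.id)
    {a : Module.End ℂ X →ₗ[ℂ] Module.End ℂ Z} {b : Module.End ℂ Y →ₗ[ℂ] Module.End ℂ W}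
    (ha : IsCP a) (hb : IsCP b)
    (h : (∑ i, sandwich (LinearMap.adjoint (G i))) ∘ₗ a = b ∘ₗ sandwich F) :
    ∃ l : Module.End ℂ Y →ₗ[ℂ] Module.End ℂ Z, IsCP l ∧
      l ∘ₗ sandwich F = a ∧ (∑ i, sandwich (LinearMap.adjoint (G i))) ∘ₗ l = b := by
  obtain ⟨n, hn⟩ := ha.exists_kraus
  obtain ⟨m, hm⟩ := hb.exists_kraus
  obtain ⟨B, rfl⟩ := hm (Fin (max n m) × ι) (by
    rw [Fintype.card_prod, Fintype.card_fin]
    exact (le_max_right n m).trans (Nat.le_mul_of_pos_right _ Fintype.card_pos))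
  obtain ⟨A, rfl⟩ := hn (Fin (max n m)) (by simp)
  obtain ⟨u, hu, hAB⟩ := exists_unitary_of_sum_sandwich_eq (fun j => B j ∘ₗ F)
    (fun j => LinearMap.adjoint (G j.2) ∘ₗ A j.1) (by
      refine Eq.trans ?_ (h.symm.trans ?_)
      · simp only [sum_comp, sandwich_comp_sandwich]
      · rw [comp_sum, Fintype.sum_prod_type]
        simp only [sum_comp, sandwich_comp_sandwich])
  -- Here the Kraus family of `b` is the one rotated, to agree with `(G i)† ∘ A l` after composing
  -- with `F`.
  let D (j) : Y →ₗ[ℂ] W := ∑ k, u j k • B k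
  have hDF (j) : D j ∘ₗ F = LinearMap.adjoint (G j.2) ∘ₗ A j.1 := by
    simp only [D, hAB, sum_comp, LinearMap.smul_comp]
  -- The unique operator whose component under `(G i)†` is `D (l, i)`.
  let E (l) : Y →ₗ[ℂ] Z := ∑ i, G i ∘ₗ D (l, i)
  have hGE (l i) : LinearMap.adjoint (G i) ∘ₗ E l = D (l, i) := by
    simp only [E, comp_sum, ← LinearMap.comp_assoc, hG]
    rw [Finset.sum_eq_single i]
    · simp
    · intro j _ hj
      simp [hj.symm]
    · simp
  have hEF (l) : E l ∘ₗ F = A l := by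
    simp only [E, sum_comp, LinearMap.comp_assoc, hDF]
    simp only [← LinearMap.comp_assoc, ← sum_comp, hG', LinearMap.id_comp]
  refine ⟨∑ l, sandwich (E l), isCP_sum_sandwich E, ?_, ?_⟩
  · simp only [sum_comp, sandwich_comp_sandwich, hEF]
  · rw [← sum_sandwich_unitary hu B, Fintype.sum_prod_type, comp_sum]
    simp only [sum_comp, sandwich_comp_sandwich, hGE, D]

/-- Whiskering preserves having a single Kraus operator, so `exists_lift_sandwich` applies. For `C =
0` the statement fails: with `G = 0` a diagonal would force the arbitrary map `a` to vanish. -/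
theorem tensorLifts_mixedState_ofKraus {C Z W : Quant} (hC : nonzero C) (G : Z →ₗ[ℂ] W) :
    TensorLifts (mixedState C) (ofKraus G) := fun A B => ⟨fun {a b} sq => by
  have : Nontrivial C := hC
  have : Nonempty (Fin (Module.finrank ℂ C)) := ⟨⟨0, Module.finrank_pos⟩⟩
  have hf : (mixedState C ▷ A).toLinearMap = ∑ i, sandwich (ketLeft C A i) :=
    superTensor_identityState_id
  have hg : (ofKraus G ▷ B).toLinearMap = sandwich (TensorProduct.map G LinearMap.id) :=
    sandwich_superTensor_id G
  have hw := congrArg Hom.toLinearMap sq.w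
  rw [comp_toLinearMap, comp_toLinearMap, hf, hg] at hw
  obtain ⟨l, hl, h1, h2⟩ := exists_lift_sandwich (X := tensorSys unitSys A) (Y := tensorSys C A)
    (Z := tensorSys Z B) (W := tensorSys W B) _ adjoint_ketLeft_comp_ketLeft
    sum_ketLeft_comp_adjoint_ketLeft _ a.isCP b.isCP hw
  exact ⟨⟨{ l := ⟨l, hl⟩
            fac_left := hom_ext ((congrArg (l ∘ₗ ·) hf).trans h1)
            fac_right := hom_ext ((congrArg (· ∘ₗ l) hg).trans h2) }⟩⟩⟩

theorem tensorLifts_ofKraus_discardEffect {C X Y : Quant} (hC : nonzero C) (F : X →ₗ[ℂ] Y) :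
    TensorLifts (ofKraus F) (discardEffect C) := fun A B => ⟨fun {a b} sq => by
  have : Nontrivial C := hC
  have : Nonempty (Fin (Module.finrank ℂ C)) := ⟨⟨0, Module.finrank_pos⟩⟩
  have hf : (ofKraus F ▷ A).toLinearMap = sandwich (TensorProduct.map F LinearMap.id) :=
    sandwich_superTensor_id F
  have hg : (discardEffect C ▷ B).toLinearMap =
      ∑ i, sandwich (LinearMap.adjoint (ketLeft C B i)) :=
    superTensor_traceEffect_id
  have hw := congrArg Hom.toLinearMap sq.w
  rw [comp_toLinearMap, comp_toLinearMap, hf, hg] at hw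
  obtain ⟨l, hl, h1, h2⟩ := exists_sandwich_lift (X := tensorSys X A) (Y := tensorSys Y A)
    (Z := tensorSys C B) (W := tensorSys unitSys B) _ _ adjoint_ketLeft_comp_ketLeft
    sum_ketLeft_comp_adjoint_ketLeft a.isCP b.isCP hw
  exact ⟨⟨{ l := ⟨l, hl⟩
            fac_left := hom_ext ((congrArg (l ∘ₗ ·) hf).trans h1)
            fac_right := hom_ext ((congrArg (· ∘ₗ l) hg).trans h2) }⟩⟩⟩

/-- A Kraus decomposition indexed by a basis of a nonzero Hilbert space. -/
theorem exists_kraus_finrank {A B : Quant} (f : A ⟶ B) :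
    ∃ C : Quant, nonzero C ∧ ∃ k : Fin (Module.finrank ℂ C) → A →ₗ[ℂ] B,
      f.toLinearMap = ∑ i, sandwich (k i) := by
  obtain ⟨n, hn⟩ := f.isCP.exists_kraus
  -- Dimension `n + 1` rather than `n` keeps the ancilla nonzero.
  refine ⟨⟨EuclideanSpace ℂ (Fin (n + 1))⟩, ?_, hn _ ?_⟩
  · exact inferInstanceAs (Nontrivial (EuclideanSpace ℂ (Fin (n + 1))))
  · rw [Fintype.card_fin]
    exact (finrank_euclideanSpace_fin (𝕜 := ℂ) (n := n + 1)).symm ▸ n.le_succ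

theorem exists_purification {A B : Quant} (f : A ⟶ B) :
    ∃ C : Quant, nonzero C ∧ ∃ G : A ⊗[ℂ] C →ₗ[ℂ] B,
      f = (ρ_ A).inv ≫ (A ◁ mixedState C) ≫ ofKraus (H := tensorSys A C) G := by
  obtain ⟨C, hC, k, hk⟩ := exists_kraus_finrank f
  let b := stdOrthonormalBasis ℂ C
  -- `G (x ⊗ b i) = k i x`, so feeding in the density `∑ i, |b i⟩⟨b i|` sums the Kraus terms.
  let G : A ⊗[ℂ] C →ₗ[ℂ] B := ∑ i, k i ∘ₗ (TensorProduct.rid ℂ A).toLinearMap ∘ₗ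
    TensorProduct.map LinearMap.id (innerₛₗ ℂ (b i))
  refine ⟨C, hC, G, hom_ext ?_⟩
  have h : f.toLinearMap = (sandwich G ∘ₗ superTensor LinearMap.id (identityState C)) ∘ₗ
      conj (ridIsometry ℂ A).symm := by
    rw [hk, id_superTensor_identityState, conj_eq_sandwich]
    simp only [comp_sum, sum_comp, sandwich_comp_sandwich]
    refine Finset.sum_congr rfl fun i _ => congrArg sandwich (LinearMap.ext fun x => ?_)
    simp [G, b, OrthonormalBasis.inner_eq_ite, apply_ite]
  exact h

theorem exists_copurification {A B : Quant} (f : A ⟶ B) :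
    ∃ C : Quant, nonzero C ∧ ∃ F : A →ₗ[ℂ] C ⊗[ℂ] B,
      f = ofKraus (K := tensorSys C B) F ≫ (discardEffect C ▷ B) ≫ (λ_ B).hom := by
  obtain ⟨C, hC, k, hk⟩ := exists_kraus_finrank f
  let b := stdOrthonormalBasis ℂ C
  -- `F x = ∑ i, b i ⊗ k i x`; tracing out `C` in the basis `b` leaves the sum of the Kraus terms.
  let F : A →ₗ[ℂ] C ⊗[ℂ] B := ∑ i, TensorProduct.mk ℂ C B (b i) ∘ₗ k i
  refine ⟨C, hC, F, hom_ext ?_⟩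
  have h : f.toLinearMap = (conj (lidIsometry ℂ B) ∘ₗ superTensor (traceEffect C) LinearMap.id) ∘ₗ
      sandwich F := by
    rw [hk, superTensor_traceEffect_id, conj_eq_sandwich]
    simp only [comp_sum, sum_comp, sandwich_comp_sandwich]
    refine Finset.sum_congr rfl fun i _ => congrArg sandwich (LinearMap.ext fun x => ?_)
    simp [F, b, adjoint_ketLeft, OrthonormalBasis.inner_eq_ite]
  exact h

theorem pureMorphisms_ofKraus {Z W : Quant} (G : Z →ₗ[ℂ] W) :
    pureMorphisms mixedStates (ofKraus G) := by
  rintro _ _ _ ⟨C⟩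
  exact tensorLifts_mixedState_ofKraus C.2 G

theorem copureMorphisms_ofKraus {X Y : Quant} (F : X →ₗ[ℂ] Y) :
    copureMorphisms discardEffects (ofKraus F) := by
  rintro _ _ _ ⟨C⟩
  exact tensorLifts_ofKraus_discardEffect C.2 F

theorem hasPurification : HasPurification mixedStates := fun A B f => by
  obtain ⟨C, hC, G, h⟩ := exists_purification f
  exact ⟨⟨C, hC⟩, _, pureMorphisms_ofKraus _, h⟩

theorem hasCopurification : HasCopurification discardEffects := fun A B f => by
  obtain ⟨C, hC, F, h⟩ := exists_copurification f
  exact ⟨⟨C, hC⟩, _, copureMorphisms_ofKraus _, h⟩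

end Quant

/-! ### Transfer to nonzero Hilbert spaces -/

namespace NonzeroQuant
open MonoidalLifting

/-- Tensor products are computed in `Quant` and the subcategory is full, so a diagonal found in
`Quant` is one here. -/
theorem tensorLifts_of_hom {X Y Z W : NonzeroQuant} {f : X ⟶ Y} {g : Z ⟶ W}
    (h : TensorLifts f.hom g.hom) : TensorLifts f g := fun A B =>
  have : HasLiftingProperty (f ▷ A).hom (g ▷ B).hom := h A.obj B.obj
  ObjectProperty.hasLiftingProperty_of_hom _ _

theorem pureMorphisms_ofKraus {Z W : NonzeroQuant} (G : Z.obj →ₗ[ℂ] W.obj) :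
    pureMorphisms mixedStates (ObjectProperty.homMk (Quant.ofKraus G) : Z ⟶ W) := by
  rintro _ C _ ⟨_⟩
  exact tensorLifts_of_hom (Quant.tensorLifts_mixedState_ofKraus C.property G)

theorem copureMorphisms_ofKraus {X Y : NonzeroQuant} (F : X.obj →ₗ[ℂ] Y.obj) :
    copureMorphisms discardEffects (ObjectProperty.homMk (Quant.ofKraus F) : X ⟶ Y) := by
  rintro C _ _ ⟨_⟩
  exact tensorLifts_of_hom (Quant.tensorLifts_ofKraus_discardEffect C.property F)

theorem hasPurification : HasPurification mixedStates := fun A B f => by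
  obtain ⟨C, hC, G, h⟩ := Quant.exists_purification f.hom
  exact ⟨⟨C, hC⟩, _, pureMorphisms_ofKraus (Z := A ⊗ ⟨C, hC⟩) G, InducedCategory.hom_ext h⟩

theorem hasCopurification : HasCopurification discardEffects := fun A B f => by
  obtain ⟨C, hC, F, h⟩ := Quant.exists_copurification f.hom
  exact ⟨⟨C, hC⟩, _, copureMorphisms_ofKraus (Y := ⟨C, hC⟩ ⊗ B) F, InducedCategory.hom_ext h⟩

end NonzeroQuant

end

theorem mainTheorem1 :
    (MonoidalLifting.HasPurification Quant.mixedStates ∧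
      MonoidalLifting.HasCopurification Quant.discardEffects ∧
      MonoidalLifting.IsSymmetricMonoidalWFS (MonoidalLifting.mixingMorphisms Quant.mixedStates)
        (MonoidalLifting.pureMorphisms Quant.mixedStates) ∧
      MonoidalLifting.IsSymmetricMonoidalWFS (MonoidalLifting.copureMorphisms Quant.discardEffects)
        (MonoidalLifting.discardingMorphisms Quant.discardEffects)) ∧
    (MonoidalLifting.HasPurification NonzeroQuant.mixedStates ∧
      MonoidalLifting.HasCopurification NonzeroQuant.discardEffects ∧
      MonoidalLifting.IsSymmetricMonoidalWFS (MonoidalLifting.mixingMorphisms NonzeroQuant.mixedStates)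
        (MonoidalLifting.pureMorphisms NonzeroQuant.mixedStates) ∧
      MonoidalLifting.IsSymmetricMonoidalWFS (MonoidalLifting.copureMorphisms NonzeroQuant.discardEffects)
        (MonoidalLifting.discardingMorphisms NonzeroQuant.discardEffects)) := by
  exact
    ⟨⟨Quant.hasPurification, Quant.hasCopurification,
      Quant.hasPurification.isSymmetricMonoidalWFS,
      Quant.hasCopurification.isSymmetricMonoidalWFS⟩,
    ⟨NonzeroQuant.hasPurification, NonzeroQuant.hasCopurification,
      NonzeroQuant.hasPurification.isSymmetricMonoidalWFS,
      NonzeroQuant.hasCopurification.isSymmetricMonoidalWFS⟩⟩
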